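/- Let $X=C[0,1]$ with the norm $|u|_\infty=\max_{[0,1]}|u|$. Let $k(t,s)=t(1-s)$ for $t\le s$ and $k(t,s)=s(1-t)$ for $s\le t$, and let $f(x)=a_2x^2+a_1x+a_0$ with $a_2=10^{-2}$, $a_1=2.5\cdot10^{-3}$, $a_0=1$. Put $$T(u)(t)=\int_0^1 k(t,s)f(u(s))\,ds\quad(u\in X),\qquad K=\Big\{u\in X:\ u\ge0,\ \min_{[1/4,3/4]}u\ge\tfrac14|u|_\infty\Big\},$$ $$K_1=\{v\in K:|v|_\infty=1\},\qquad \mathcal F(u,v,w)=\int_0^1 v w\,dt-\int_0^1 u w\,dt,$$ and, for $v\in K_1$ and $t\ge0$, define the radial energy $\mathcal E(v)(t)=\int_0^t\mathcal F(T(sv),sv,v)\,ds$. Put also $\alpha_v(j)=\int_0^1\int_0^1k(t,s)v(s)^jv(t)\,ds\,dt$. Then the following hold. (i) $K$ is a nondegenerate cone, that is, a closed convex set with $\lambda K\subset K$ for all $\lambda\ge0$ and $K\ne\{0\}$. The operator $T$ is completely continuous on $X$, that is, continuous and mapping bounded sets to relatively compact sets. Moreover $T(K)\subset K$, and $\mathcal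 F$ is continuous on $K\times K\times K_1$. (ii) For every $v\in K_1$ one has $\alpha_v(2)>0$ and, for $t\ge0$, $$\mathcal E(v)(t)=-a_2\alpha_v(2)\frac{t^3}{3}+\big(|v|_{L^2}^2-a_1\alpha_v(1)\big)\frac{t^2}{2}-a_0\alpha_v(0)\,t .$$ This cubic has exactly two critical points $t_-<t_+$ in $(0,\infty)$. The point $t_+$ lies in $(10,10^7)$ and is the unique global maximum point of $\mathcal E(v)$ on $[0,\infty)$, and $t_-$ is a local minimum point. (iii) With $r=0$ and $R=\infty$ the following conditions are satisfied. (h1) There are $0<r_0<R_0<\infty$ such that for every $v\in K_1$ the function $\mathcal E(v)$ has a unique maximum point $t_v$ on $[0,\infty)$, and $r_0<t_v<R_0$. (h2) $\inf_{u\in U_b}|T(u)|_\infty>0$, where $U_b=\{t_vv:v\in K_1\}$. (h3) If $\mathcal F(tu,u,u/|u|_\infty)=0$ for some $t>0$ and $u\in K\setminus\{0\}$, then $t=1$. (iv) $T$ has a fixed point in $U_b$, that is, there is $u\in U_b$ with $T(u)=u$. -/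

import Mathlib

open Set Filter Topology MeasureTheory
open scoped unitInterval ENNReal

noncomputable section

namespace NehariCone

/-! ## The abstract setting: cones, radial energies and the Nehari-type manifold -/

section Abstract

/-- A nondegenerate cone (wedge): a closed convex set, stable under multiplication by
nonnegative scalars, containing a nonzero vector. -/
structure IsNondegenerateCone {X : Type*} [NormedAddCommGroup X] [NormedSpace ℝ X]
    (K : Set X) : Prop where
  isClosed : IsClosed K
  convex : Convex ℝ K
  smul_mem : ∀ c : ℝ, 0 ≤ c → ∀ u ∈ K, c • u ∈ K
  exists_ne_zero : ∃ u ∈ K, u ≠ 0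

/-- `T` is completely continuous on `S`: it is continuous on `S` and maps bounded subsets of `S`
to relatively compact sets. -/
def CompletelyContinuousOn {X : Type*} [NormedAddCommGroup X] (T : X → X) (S : Set X) : Prop :=
  ContinuousOn T S ∧
    ∀ B : Set X, B ⊆ S → Bornology.IsBounded B → IsCompact (closure (T '' B))

/-- `K_ρ`, the elements of `K` of norm `ρ`. -/
def normSlice {X : Type*} [NormedAddCommGroup X] (K : Set X) (ρ : ℝ) : Set X :=
  {v | v ∈ K ∧ ‖v‖ = ρ}

/-- The radial energy `ℰ(v)(t) = ∫₀ᵗ 𝓕(T(sv), sv, v) ds` in direction `v`. -/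
def radialEnergy {X : Type*} [NormedAddCommGroup X] [NormedSpace ℝ X]
    (T : X → X) (F : X → X → X → ℝ) (v : X) (t : ℝ) : ℝ :=
  ∫ s in (0 : ℝ)..t, F (T (s • v)) (s • v) v

/-- The real points of `[r, R]`, where `R = ∞` is allowed. -/
def radii (r : ℝ) (R : EReal) : Set ℝ :=
  {t | r ≤ t ∧ (t : EReal) ≤ R}

/-- `t` is a maximum point of the radial energy `ℰ(v)` on `[r, R]`. -/
def IsRadialMax {X : Type*} [NormedAddCommGroup X] [NormedSpace ℝ X]
    (T : X → X) (F : X → X → X → ℝ) (r : ℝ) (R : EReal) (v : X) (t : ℝ) : Prop :=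
  t ∈ radii r R ∧ ∀ s ∈ radii r R, radialEnergy T F v s ≤ radialEnergy T F v t

/-- Condition (h1): there are `r₀ > 0` and `R₀ < ∞` with `r ≤ r₀ < R₀ ≤ R` such that for every
`v ∈ K₁` the energy `ℰ(v)` has a unique maximum point `t_v` on `[r, R]`, and `r₀ < t_v < R₀`. -/
def CondH1 {X : Type*} [NormedAddCommGroup X] [NormedSpace ℝ X]
    (K : Set X) (T : X → X) (F : X → X → X → ℝ) (r : ℝ) (R : EReal) : Prop :=
  ∃ r₀ R₀ : ℝ, 0 < r₀ ∧ r ≤ r₀ ∧ r₀ < R₀ ∧ (R₀ : EReal) ≤ R ∧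
    ∀ v ∈ normSlice K 1, ∃ t : ℝ, IsRadialMax T F r R v t ∧
      (∀ t' : ℝ, IsRadialMax T F r R v t' → t' = t) ∧ r₀ < t ∧ t < R₀

/-- The Nehari-type manifold `U_b = {t_v v : v ∈ K₁}`, where `t_v` is the maximum point of `ℰ(v)`
on `[r, R]` (unique under (h1)). -/
def nehariManifold {X : Type*} [NormedAddCommGroup X] [NormedSpace ℝ X]
    (K : Set X) (T : X → X) (F : X → X → X → ℝ) (r : ℝ) (R : EReal) : Set X :=
  {u | ∃ v ∈ normSlice K 1, ∃ t : ℝ, IsRadialMax T F r R v t ∧ u = t • v}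

/-- Condition (h2): `inf_{u ∈ U_b} |T(u)| > 0`, the infimum being taken in `[0, ∞]`. -/
def CondH2 {X : Type*} [NormedAddCommGroup X] [NormedSpace ℝ X]
    (K : Set X) (T : X → X) (F : X → X → X → ℝ) (r : ℝ) (R : EReal) : Prop :=
  0 < ⨅ u ∈ nehariManifold K T F r R, ‖T u‖ₑ

/-- Condition (h3): if `𝓕(tu, u, u/|u|) = 0` with `t > 0` and `u ∈ K \ {0}`, then `t = 1`. -/
def CondH3 {X : Type*} [NormedAddCommGroup X] [NormedSpace ℝ X]
    (K : Set X) (F : X → X → X → ℝ) : Prop :=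
  ∀ t : ℝ, 0 < t → ∀ u ∈ K, u ≠ 0 → F (t • u) u (‖u‖⁻¹ • u) = 0 → t = 1

end Abstract

/-! ## The Hammerstein operator on `C[0,1]` with the sup norm -/

/-- The Green kernel: `k(t,s) = t(1-s)` for `t ≤ s` and `k(t,s) = s(1-t)` for `s ≤ t`. -/
def green (t s : ℝ) : ℝ := if t ≤ s then t * (1 - s) else s * (1 - t)

def a₂ : ℝ := 1 / 10 ^ 2

def a₁ : ℝ := 2.5 / 10 ^ 3

def a₀ : ℝ := 1

/-- The nonlinearity `f(x) = a₂ x² + a₁ x + a₀`. -/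
def nonlin (x : ℝ) : ℝ := a₂ * x ^ 2 + a₁ * x + a₀

theorem continuous_green : Continuous fun p : ℝ × ℝ => green p.1 p.2 := by
  unfold green
  refine Continuous.if_le (by fun_prop) (by fun_prop) (by fun_prop) (by fun_prop) ?_
  rintro ⟨x, y⟩ h
  simp only at h
  subst h
  rfl

theorem continuous_nonlin : Continuous nonlin := by
  unfold nonlin
  fun_prop

theorem continuous_hammerstein (u : C(I, ℝ)) :
    Continuous fun t : I => ∫ s : I, green t s * nonlin (u s) := by
  have h : Continuous (Function.uncurry fun t s : I => green t s * nonlin (u s)) := by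
    refine Continuous.mul ?_ ?_
    · exact continuous_green.comp
        ((continuous_subtype_val.comp continuous_fst).prodMk
          (continuous_subtype_val.comp continuous_snd))
    · exact continuous_nonlin.comp (u.continuous.comp continuous_snd)
  have h2 := continuous_parametric_integral_of_continuous (μ := (volume : Measure I)) h
    isCompact_univ
  simpa only [Measure.restrict_univ] using h2

/-- The Hammerstein operator `T(u)(t) = ∫₀¹ k(t,s) f(u(s)) ds` on `C[0,1]`. -/
def hammerstein (u : C(I, ℝ)) : C(I, ℝ) :=
  ⟨fun t : I => ∫ s : I, green t s * nonlin (u s), continuous_hammerstein u⟩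

/-- The cone of all `u ≥ 0` in `C[0,1]` with `min_{[1/4,3/4]} u ≥ |u|_∞ / 4`. -/
def coneK : Set C(I, ℝ) :=
  {u | (∀ t : I, 0 ≤ u t) ∧
    ∀ t : I, (1 / 4 : ℝ) ≤ t → (t : ℝ) ≤ 3 / 4 → 1 / 4 * ‖u‖ ≤ u t}

/-- `𝓕(u,v,w) = ∫₀¹ v w dt - ∫₀¹ u w dt`. -/
def potential (u v w : C(I, ℝ)) : ℝ :=
  (∫ t : I, v t * w t) - ∫ t : I, u t * w t

/-- `α_u(j) = ∫₀¹ ∫₀¹ k(t,s) u(s)^j u(t) ds dt`. -/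
def alpha (u : C(I, ℝ)) (j : ℕ) : ℝ :=
  ∫ t : I, ∫ s : I, green t s * u s ^ j * u t

/-- The radial energy of the example. -/
def energy (v : C(I, ℝ)) (t : ℝ) : ℝ := radialEnergy hammerstein potential v t

end NehariCone

end

open Set Filter Topology MeasureTheory
open scoped unitInterval ENNReal

noncomputable section

namespace NehariCone

/-! ## Integrals of continuous functions on the unit interval -/

/-! Expanding `nonlin` shows that `s ↦ 𝓕(T(sv), sv, v)` is a concave quadratic whose coefficients
are `∫ v²` and the moments `alpha v j` (`potential_radial`). For `v ∈ K₁` the cone gives `v ≥ 1/4`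
on the middle half; with bounds on the kernel this controls the coefficients uniformly, and the
quadratic is negative at `0`, positive at `3` and `10`, negative at `10^7`. So its roots satisfy `tm
< 3` and `10 < tp < 10^7` (`exists_radial_profile`); in particular `tp > 3 * tm`, which is what
makes `tp` the global maximum of the cubic.

The fixed point is not obtained variationally. If `T u = u`, then `‖u‖` is a root of the quadratic
in the direction `u/‖u‖`, so `‖u‖ ≥ 3` already forces `‖u‖ = tp` and puts `u` on the manifold. It
remains to find a large solution of `-u'' = f(u)`, `u(0) = u(1) = 0`, which the time map supplies.
With `G' = f` and maximum `M`, the first integral is `u'²/2 = G(M) - G(u)`; the substitution `u =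
M(1 - ρ²)` removes the singularity at the maximum and leaves `ρ' = √(q(ρ)/(2M))` with `q = timeQuot
M`. The boundary conditions say that `ρ` runs from `-1` to `1` in time `1`, and a suitable `M ≥ 20`
exists by the intermediate value theorem (`exists_timeMap_eq_one`). -/

theorem _root_.Continuous.integrable_unitInterval {f : I → ℝ} (hf : Continuous f) :
    Integrable f :=
  hf.integrable_of_hasCompactSupport (HasCompactSupport.of_compactSpace f)

theorem continuous_integral_unitInterval : Continuous fun w : C(I, ℝ) => ∫ t : I, w t := by
  refine LipschitzWith.continuous (K := 1) (LipschitzWith.of_dist_le_mul fun w z => ?_)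
  rw [Real.dist_eq, ← integral_sub w.continuous.integrable_unitInterval
    z.continuous.integrable_unitInterval, dist_eq_norm, NNReal.coe_one, one_mul]
  have h := norm_integral_le_of_norm_le_const (μ := (volume : Measure I)) (C := ‖w - z‖)
    (f := fun t => w t - z t) (ae_of_all _ fun t => (w - z).norm_coe_le_norm t)
  simpa using h

theorem integral_nonneg_mono {f g : I → ℝ} (hf : Continuous f) (hg : Continuous g)
    (h : ∀ t, f t ≤ g t) : ∫ t : I, f t ≤ ∫ t : I, g t :=
  integral_mono hf.integrable_unitInterval hg.integrable_unitInterval h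

/-- The middle half `[1/4, 3/4]` of the unit interval. -/
def middle : Set I := Icc ⟨1 / 4, by norm_num, by norm_num⟩ ⟨3 / 4, by norm_num, by norm_num⟩

theorem mem_middle {t : I} : t ∈ middle ↔ (1 / 4 : ℝ) ≤ t ∧ (t : ℝ) ≤ 3 / 4 := Iff.rfl

/-- A nonnegative continuous function that is at least `c` on the middle half has integral at
least `c / 2`. -/
theorem half_le_integral {f : I → ℝ} (hf : Continuous f) (h0 : ∀ t, 0 ≤ f t) {c : ℝ}
    (h : ∀ t ∈ middle, c ≤ f t) : c / 2 ≤ ∫ t : I, f t := by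
  have h1 : ∫ t in middle, f t ≤ ∫ t : I, f t :=
    setIntegral_le_integral hf.integrable_unitInterval (ae_of_all _ h0)
  have h2 : ∫ _ in middle, c ≤ ∫ t in middle, f t :=
    setIntegral_mono_on (by simp) hf.integrable_unitInterval.integrableOn measurableSet_Icc h
  have h3 : ∫ _ in middle, c = c / 2 := by
    rw [setIntegral_const, measureReal_def, middle, unitInterval.volume_Icc]
    norm_num
    ring
  linarith

/-! ## The Green kernel and the nonlinearity -/

@[fun_prop]
theorem continuous_green_comp {Y : Type*} [TopologicalSpace Y] {f g : Y → ℝ}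
    (hf : Continuous f) (hg : Continuous g) : Continuous fun y => green (f y) (g y) :=
  continuous_green.comp (hf.prodMk hg)

attribute [fun_prop] continuous_nonlin

theorem green_nonneg (t s : I) : 0 ≤ green t s := by
  have := t.2.1; have := t.2.2; have := s.2.1; have := s.2.2
  unfold green
  split_ifs <;> apply mul_nonneg <;> linarith

theorem green_le (t s : I) : green t s ≤ 1 / 4 := by
  have := t.2.1; have := t.2.2; have := s.2.1; have := s.2.2
  unfold green
  split_ifs <;> nlinarith [sq_nonneg ((t : ℝ) - 1 / 2), sq_nonneg ((s : ℝ) - 1 / 2)]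

/-- `green · s` is piecewise linear with slopes `1 - s` and `-s`. This makes the image of a bounded
set equi-Lipschitz. -/
theorem abs_green_sub_le (t t' s : I) : |green t s - green t' s| ≤ |(t : ℝ) - t'| := by
  have := t.2.1; have := t.2.2; have := s.2.1; have := s.2.2; have := t'.2.1; have := t'.2.2
  rw [abs_le]
  unfold green
  rcases abs_cases ((t : ℝ) - t') with ⟨h, _⟩ | ⟨h, _⟩ <;> rw [h] <;>
    split_ifs <;> constructor <;> nlinarith

/-- Both sides compare with `s(1 - s)`: it bounds `green r s` from above, and `min(t, 1 - t) ≥ 1/4`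
times it bounds `green t s` from below. Integrated, this is the cone inequality for `T(u)`. -/
theorem quarter_green_le {t : I} (ht : t ∈ middle) (r s : I) :
    1 / 4 * green r s ≤ green t s := by
  have := s.2.1; have := s.2.2; have := r.2.1; have := r.2.2
  obtain ⟨h1, h2⟩ := mem_middle.1 ht
  unfold green
  split_ifs <;> nlinarith

theorem le_green {t s : I} (ht : t ∈ middle) (hs : s ∈ middle) : 1 / 16 ≤ green t s := by
  obtain ⟨h1, h2⟩ := mem_middle.1 ht
  obtain ⟨h3, h4⟩ := mem_middle.1 hs
  unfold green
  split_ifs <;> nlinarith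

/-- Valid for negative `x` too, so the lower bounds on `T(u)` need no sign condition on `u`. -/
theorem half_le_nonlin (x : ℝ) : 1 / 2 ≤ nonlin x := by
  unfold nonlin a₂ a₁ a₀
  nlinarith [sq_nonneg (x + 1 / 8)]

/-! ## The linear integral operator -/

/-- The linear operator `w ↦ ∫₀¹ k(·,s) w(s) ds` as a map on `C[0,1]`. -/
def greenOp (w : C(I, ℝ)) : C(I, ℝ) where
  toFun t := ∫ s : I, green t s * w s
  continuous_toFun := by
    have h := continuous_parametric_integral_of_continuous (μ := (volume : Measure I))
      (f := fun t s : I => green t s * w s) (by simp only [Function.uncurry_def]; fun_prop)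
      isCompact_univ
    simpa only [Measure.restrict_univ] using h

theorem greenOp_apply (w : C(I, ℝ)) (t : I) : greenOp w t = ∫ s : I, green t s * w s := rfl

theorem hammerstein_apply (u : C(I, ℝ)) (t : I) :
    hammerstein u t = ∫ s : I, green t s * nonlin (u s) := rfl

theorem hammerstein_eq (u : C(I, ℝ)) :
    hammerstein u = greenOp ((⟨nonlin, continuous_nonlin⟩ : C(ℝ, ℝ)).comp u) := rfl

theorem abs_integral_mul_le (w : C(I, ℝ)) {g : I → ℝ} {c : ℝ} (hg : ∀ s, |g s| ≤ c) :
    |∫ s : I, g s * w s| ≤ c * ‖w‖ := by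
  have hb : ∀ s, ‖g s * w s‖ ≤ c * ‖w‖ := fun s => by
    rw [norm_mul]
    exact mul_le_mul (hg s) (w.norm_coe_le_norm s) (norm_nonneg _) ((abs_nonneg _).trans (hg s))
  simpa using norm_integral_le_of_norm_le_const (μ := (volume : Measure I)) (ae_of_all _ hb)

theorem abs_greenOp_apply_le (w : C(I, ℝ)) (t : I) : |greenOp w t| ≤ ‖w‖ := by
  have h := abs_integral_mul_le w (g := fun s => green t s) (c := 1) fun s => by
    rw [abs_of_nonneg (green_nonneg t s)]
    linarith [green_le t s]
  rwa [one_mul] at h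

theorem abs_greenOp_apply_sub_le (w : C(I, ℝ)) (t t' : I) :
    |greenOp w t - greenOp w t'| ≤ |(t : ℝ) - t'| * ‖w‖ := by
  have h := abs_integral_mul_le w (abs_green_sub_le t t')
  simp only [sub_mul] at h
  rwa [integral_sub (Continuous.integrable_unitInterval (by fun_prop))
    (Continuous.integrable_unitInterval (by fun_prop))] at h

theorem continuous_greenOp : Continuous greenOp := by
  refine LipschitzWith.continuous (K := 1) (LipschitzWith.of_dist_le_mul fun w z => ?_)
  rw [NNReal.coe_one, one_mul, ContinuousMap.dist_le dist_nonneg]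
  intro t
  rw [Real.dist_eq, dist_eq_norm]
  have h := abs_greenOp_apply_le (w - z) t
  simp only [greenOp_apply, ContinuousMap.sub_apply, mul_sub] at h
  rwa [integral_sub (Continuous.integrable_unitInterval (by fun_prop))
    (Continuous.integrable_unitInterval (by fun_prop))] at h

theorem isCompact_lipschitz_ball (C : ℝ) :
    IsCompact {w : C(I, ℝ) | (∀ t, |w t| ≤ C) ∧ ∀ t t', |w t - w t'| ≤ |(t : ℝ) - t'| * C} := by
  apply ArzelaAscoli.isCompact_of_equicontinuous
  -- The Lipschitz bound is closed under pointwise limits and itself implies continuity, so the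
  -- family is a closed subset of a product of compact intervals.
  · have hK : IsCompact (Set.pi univ fun _ : I => Icc (-C) C) :=
      isCompact_univ_pi fun _ => isCompact_Icc
    have hcl : IsClosed {f : I → ℝ | ∀ t t', |f t - f t'| ≤ |(t : ℝ) - t'| * C} := by
      simp only [ofPred_forall]
      refine isClosed_iInter fun t => isClosed_iInter fun t' => isClosed_le ?_ continuous_const
      fun_prop
    convert hK.inter_right hcl
    ext f
    constructor
    · rintro ⟨w, ⟨h1, h2⟩, rfl⟩
      exact ⟨fun t _ => abs_le.1 (h1 t), h2⟩
    · rintro ⟨h1, h2⟩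
      have hf : Continuous f := by
        refine LipschitzWith.continuous (K := C.toNNReal)
          (LipschitzWith.of_dist_le_mul fun t t' => ?_)
        rw [mul_comm, Real.dist_eq]
        exact (h2 t t').trans
          (mul_le_mul_of_nonneg_left (Real.le_coe_toNNReal C) (abs_nonneg _))
      exact ⟨⟨f, hf⟩, ⟨fun t => abs_le.2 (h1 t trivial), h2⟩, rfl⟩
  · refine (LipschitzWith.uniformEquicontinuous _ C.toNNReal fun w => ?_).equicontinuous
    refine LipschitzWith.of_dist_le_mul fun t t' => ?_
    rw [mul_comm, Real.dist_eq]
    exact (w.2.2 t t').trans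
      (mul_le_mul_of_nonneg_left (Real.le_coe_toNNReal C) (abs_nonneg _))

theorem continuous_hammersteinOp : Continuous hammerstein :=
  continuous_greenOp.comp
    (ContinuousMap.continuous_postcomp (⟨nonlin, continuous_nonlin⟩ : C(ℝ, ℝ)))

theorem completelyContinuousOn_hammerstein : CompletelyContinuousOn hammerstein univ := by
  refine ⟨continuous_hammersteinOp.continuousOn, fun B _ hB => ?_⟩
  obtain ⟨R, hR⟩ := hB.exists_norm_le
  obtain ⟨C, hC⟩ := (isCompact_Icc (a := -R) (b := R)).exists_bound_of_continuousOn
    continuous_nonlin.continuousOn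
  refine (isCompact_lipschitz_ball C).closure_of_subset ?_
  rintro _ ⟨u, hu, rfl⟩
  have hn : ‖(⟨nonlin, continuous_nonlin⟩ : C(ℝ, ℝ)).comp u‖ ≤ C :=
    (ContinuousMap.norm_le_of_nonempty _).2 fun t =>
      hC _ (abs_le.1 ((u.norm_coe_le_norm t).trans (hR u hu)))
  rw [hammerstein_eq]
  exact ⟨fun t => (abs_greenOp_apply_le _ t).trans hn, fun t t' =>
    (abs_greenOp_apply_sub_le _ t t').trans (mul_le_mul_of_nonneg_left hn (abs_nonneg _))⟩

/-! ## The cone -/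

theorem hammerstein_mem_coneK (u : C(I, ℝ)) : hammerstein u ∈ coneK := by
  have hpos : ∀ t s : I, 0 ≤ green t s * nonlin (u s) := fun t s =>
    mul_nonneg (green_nonneg t s) (by linarith [half_le_nonlin (u s)])
  have h0 : ∀ t, 0 ≤ hammerstein u t := fun t => integral_nonneg (hpos t)
  refine ⟨h0, fun t h1 h2 => ?_⟩
  have hle : ‖hammerstein u‖ ≤ 4 * hammerstein u t := by
    refine (ContinuousMap.norm_le_of_nonempty _).2 fun r => ?_
    rw [Real.norm_of_nonneg (h0 r)]
    have : 1 / 4 * hammerstein u r ≤ hammerstein u t := by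
      rw [hammerstein_apply, hammerstein_apply, ← integral_const_mul]
      refine integral_nonneg_mono (by fun_prop) (by fun_prop) fun s => ?_
      rw [← mul_assoc]
      exact mul_le_mul_of_nonneg_right (quarter_green_le (mem_middle.2 ⟨h1, h2⟩) r s)
        (by linarith [half_le_nonlin (u s)])
    linarith
  linarith

theorem le_norm_hammerstein (u : C(I, ℝ)) : 1 / 64 ≤ ‖hammerstein u‖ := by
  have hm : (⟨1 / 2, by norm_num, by norm_num⟩ : I) ∈ middle := by
    rw [mem_middle]; norm_num
  have h : (1 / 32 : ℝ) / 2 ≤ hammerstein u ⟨1 / 2, by norm_num, by norm_num⟩ := by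
    rw [hammerstein_apply]
    refine half_le_integral (by fun_prop) (fun s => mul_nonneg (green_nonneg _ s)
      (by linarith [half_le_nonlin (u s)])) fun s hs => ?_
    nlinarith [le_green hm hs, half_le_nonlin (u s)]
  have := (le_abs_self _).trans ((hammerstein u).norm_coe_le_norm ⟨1 / 2, by norm_num, by norm_num⟩)
  linarith

theorem isNondegenerateCone_coneK : IsNondegenerateCone coneK where
  isClosed := by
    have : coneK = {u | ∀ t : I, 0 ≤ u t} ∩
        {u | ∀ t : I, (1 / 4 : ℝ) ≤ t → (t : ℝ) ≤ 3 / 4 → 1 / 4 * ‖u‖ ≤ u t} := rfl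
    rw [this]
    simp only [ofPred_forall]
    refine (isClosed_iInter fun t => isClosed_le continuous_const (by fun_prop)).inter
      (isClosed_iInter fun t => isClosed_iInter fun _ => isClosed_iInter fun _ =>
        isClosed_le (by fun_prop) (by fun_prop))
  convex := by
    rintro u hu v hv a b ha hb -
    refine ⟨fun t => add_nonneg (mul_nonneg ha (hu.1 t)) (mul_nonneg hb (hv.1 t)),
      fun t h1 h2 => ?_⟩
    have hn : ‖a • u + b • v‖ ≤ a * ‖u‖ + b * ‖v‖ := by
      refine (norm_add_le _ _).trans_eq ?_
      rw [norm_smul, norm_smul, Real.norm_of_nonneg ha, Real.norm_of_nonneg hb]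
    have h3 := mul_le_mul_of_nonneg_left (hu.2 t h1 h2) ha
    have h4 := mul_le_mul_of_nonneg_left (hv.2 t h1 h2) hb
    change _ ≤ a * u t + b * v t
    linarith
  smul_mem := by
    intro c hc u hu
    refine ⟨fun t => mul_nonneg hc (hu.1 t), fun t h1 h2 => ?_⟩
    have h3 := mul_le_mul_of_nonneg_left (hu.2 t h1 h2) hc
    rw [norm_smul, Real.norm_of_nonneg hc]
    change _ ≤ c * u t
    linarith
  exists_ne_zero := by
    refine ⟨hammerstein 0, hammerstein_mem_coneK 0, fun h => ?_⟩
    have := le_norm_hammerstein 0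
    rw [h, norm_zero] at this
    norm_num at this

theorem continuous_potential :
    Continuous fun p : C(I, ℝ) × C(I, ℝ) × C(I, ℝ) => potential p.1 p.2.1 p.2.2 := by
  have h1 : Continuous fun p : C(I, ℝ) × C(I, ℝ) × C(I, ℝ) => ∫ t : I, (p.2.1 * p.2.2) t :=
    continuous_integral_unitInterval.comp (by fun_prop)
  have h2 : Continuous fun p : C(I, ℝ) × C(I, ℝ) × C(I, ℝ) => ∫ t : I, (p.1 * p.2.2) t :=
    continuous_integral_unitInterval.comp (by fun_prop)
  exact h1.sub h2

/-! ## Bounds for the coefficients of the radial energy -/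

theorem alpha_eq (v : C(I, ℝ)) (j : ℕ) : alpha v j = ∫ t : I, greenOp (v ^ j) t * v t := by
  unfold alpha
  simp only [integral_mul_const]
  rfl

theorem le_one_of_mem {v : C(I, ℝ)} (hv : v ∈ normSlice coneK 1) (t : I) : v t ≤ 1 :=
  (le_abs_self _).trans ((v.norm_coe_le_norm t).trans_eq hv.2)

theorem le_of_mem_middle {v : C(I, ℝ)} (hv : v ∈ normSlice coneK 1) {t : I} (ht : t ∈ middle) :
    1 / 4 ≤ v t := by
  have := hv.1.2 t (mem_middle.1 ht).1 (mem_middle.1 ht).2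
  rwa [hv.2, mul_one] at this

theorem le_alpha {v : C(I, ℝ)} (hv : v ∈ normSlice coneK 1) (j : ℕ) :
    (1 / 4) ^ j / 256 ≤ alpha v j := by
  have h0 : ∀ t s : I, 0 ≤ green t s * v s ^ j := fun t s =>
    mul_nonneg (green_nonneg t s) (pow_nonneg (hv.1.1 s) j)
  have hpos : ∀ t, 0 ≤ greenOp (v ^ j) t := fun t => integral_nonneg (h0 t)
  have h1 : ∀ t ∈ middle, (1 / 16 * (1 / 4) ^ j) / 2 ≤ greenOp (v ^ j) t := fun t ht =>
    half_le_integral (by fun_prop) (h0 t) fun s hs =>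
      mul_le_mul (le_green ht hs) (pow_le_pow_left₀ (by norm_num) (le_of_mem_middle hv hs) j)
        (by positivity) (green_nonneg t s)
  have h2 : ((1 / 16 * (1 / 4) ^ j) / 2 * (1 / 4)) / 2 ≤ alpha v j := by
    rw [alpha_eq]
    exact half_le_integral (by fun_prop) (fun t => mul_nonneg (hpos t) (hv.1.1 t)) fun t ht =>
      mul_le_mul (h1 t ht) (le_of_mem_middle hv ht) (by norm_num) (hpos t)
  linarith

theorem alpha_le {v : C(I, ℝ)} (hv : ∀ t, 0 ≤ v t) (j : ℕ) :
    alpha v j ≤ 1 / 4 * (∫ t : I, v t ^ j) * ∫ t : I, v t := by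
  rw [alpha_eq, ← integral_const_mul]
  refine integral_nonneg_mono (by fun_prop) (by fun_prop) fun t =>
    mul_le_mul_of_nonneg_right ?_ (hv t)
  rw [greenOp_apply, ← integral_const_mul]
  exact integral_nonneg_mono (by fun_prop) (by fun_prop) fun s =>
    mul_le_mul_of_nonneg_right (green_le t s) (pow_nonneg (hv s) j)

/-- The variance of `v` is nonnegative, the unit interval having total mass `1`. -/
theorem sq_integral_le (v : C(I, ℝ)) : (∫ t : I, v t) ^ 2 ≤ ∫ t : I, v t ^ 2 := by
  set m := ∫ t : I, v t with hm
  have h : 2 * m * m - m ^ 2 ≤ ∫ t : I, v t ^ 2 := by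
    have h1 : ∫ t : I, (2 * m * v t - m ^ 2) = 2 * m * m - m ^ 2 := by
      rw [integral_sub (Continuous.integrable_unitInterval (by fun_prop)) (integrable_const _),
        integral_const_mul, ← hm]
      simp
    rw [← h1]
    exact integral_nonneg_mono (by fun_prop) (by fun_prop) fun t => by
      nlinarith [sq_nonneg (v t - m)]
  nlinarith

theorem potential_radial (v : C(I, ℝ)) (s : ℝ) :
    potential (hammerstein (s • v)) (s • v) v =
      -a₂ * alpha v 2 * s ^ 2 + ((∫ t : I, v t ^ 2) - a₁ * alpha v 1) * s
        - a₀ * alpha v 0 := by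
  have hT : ∀ t, hammerstein (s • v) t = a₂ * s ^ 2 * greenOp (v ^ 2) t
      + a₁ * s * greenOp (v ^ 1) t + a₀ * greenOp (v ^ 0) t := fun t => by
    simp only [hammerstein_apply, greenOp_apply]
    rw [← integral_const_mul, ← integral_const_mul, ← integral_const_mul, ← integral_add,
      ← integral_add]
    · congr 1
      ext x
      simp only [nonlin, ContinuousMap.smul_apply, ContinuousMap.pow_apply, smul_eq_mul]
      ring
    all_goals exact Continuous.integrable_unitInterval (by fun_prop)
  have h1 : ∫ t : I, (s • v) t * v t = s * ∫ t : I, v t ^ 2 := by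
    rw [← integral_const_mul]
    congr 1
    ext t
    simp only [ContinuousMap.smul_apply, smul_eq_mul]
    ring
  have h2 : ∫ t : I, hammerstein (s • v) t * v t =
      a₂ * s ^ 2 * alpha v 2 + a₁ * s * alpha v 1 + a₀ * alpha v 0 := by
    simp only [alpha_eq]
    rw [← integral_const_mul, ← integral_const_mul, ← integral_const_mul, ← integral_add,
      ← integral_add]
    · congr 1
      ext x
      rw [hT]
      ring
    all_goals exact Continuous.integrable_unitInterval (by fun_prop)
  rw [potential, h1, h2]
  ring

theorem energy_eq (v : C(I, ℝ)) (t : ℝ) :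
    energy v t = -a₂ * (t ^ 3 / 3) * alpha v 2
      + t ^ 2 / 2 * ((∫ s : I, v s ^ 2) - a₁ * alpha v 1) - a₀ * alpha v 0 * t := by
  unfold energy radialEnergy
  simp only [potential_radial]
  set B := (∫ s : I, v s ^ 2) - a₁ * alpha v 1
  have hd : ∀ s ∈ uIcc 0 t, HasDerivAt
      (fun t : ℝ => -a₂ * (t ^ 3 / 3) * alpha v 2 + t ^ 2 / 2 * B - a₀ * alpha v 0 * t)
      (-a₂ * alpha v 2 * s ^ 2 + B * s - a₀ * alpha v 0) s := fun s _ => by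
    have h := (((((hasDerivAt_pow 3 s).div_const 3).const_mul (-a₂)).mul_const (alpha v 2)).add
      (((hasDerivAt_pow 2 s).div_const 2).mul_const B)).sub
      ((hasDerivAt_id s).const_mul (a₀ * alpha v 0))
    refine h.congr_deriv ?_
    push_cast
    ring
  rw [intervalIntegral.integral_eq_sub_of_hasDerivAt hd
    (Continuous.intervalIntegrable (by fun_prop) _ _)]
  ring

/-! ## The shape of the radial energy -/

/-- A concave quadratic with suitable signs factors with one root below `3` and one above `10`. -/
theorem exists_factorization {A B C : ℝ} (hA : 0 < A) (hC : 0 < C)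
    (h3 : 0 < -A * 3 ^ 2 + B * 3 - C) (h10 : 0 < -A * 10 ^ 2 + B * 10 - C)
    (hB : B < A * 10 ^ 7) :
    ∃ tm tp : ℝ, 0 < tm ∧ tm < 3 ∧ 10 < tp ∧ tp < 10 ^ 7 ∧ B = A * (tm + tp) ∧
      C = A * (tm * tp) := by
  have hcont : ContinuousOn (fun s : ℝ => -A * s ^ 2 + B * s - C) (Icc 10 (10 ^ 7)) := by fun_prop
  obtain ⟨tp, ⟨h1, h2⟩, h0⟩ := intermediate_value_Ioo' (by norm_num) hcont
    (show (0 : ℝ) ∈ Ioo _ _ from ⟨by nlinarith, h10⟩)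
  simp only at h0
  have htp : 0 < tp := by linarith
  -- By Vieta the other root is `C / (A * tp)`. It lies below `3` because the value at `3` is `A *
  -- (3 - tm) * (tp - 3) > 0`.
  have hp : C = A * (C / (A * tp) * tp) := by field_simp
  have hs : B = A * (C / (A * tp) + tp) := by
    field_simp
    linarith
  set tm := C / (A * tp)
  refine ⟨tm, tp, by positivity, ?_, h1, h2, hs, hp⟩
  rw [hs, hp] at h3
  have h4 : 0 < A * ((3 - tm) * (tp - 3)) := by linarith
  have h5 := (pos_iff_pos_of_mul_pos (pos_of_mul_pos_right h4 hA.le)).2 (by linarith)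
  linarith

theorem exists_radial_profile {v : C(I, ℝ)} (hv : v ∈ normSlice coneK 1) :
    ∃ A tm tp : ℝ, 0 < A ∧ 0 < tm ∧ tm < 3 ∧ 10 < tp ∧ tp < 10 ^ 7 ∧
      (∀ s, potential (hammerstein (s • v)) (s • v) v = -A * ((s - tm) * (s - tp))) ∧
      ∀ t, energy v t = A * (-t ^ 3 / 3 + (tm + tp) * t ^ 2 / 2 - tm * tp * t) := by
  have l0 := le_alpha hv 0
  have l1 := le_alpha hv 1
  have l2 := le_alpha hv 2
  have u0 := alpha_le hv.1.1 0
  have u1 := alpha_le hv.1.1 1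
  have u2 := alpha_le hv.1.1 2
  have hsq := sq_integral_le v
  have hm0 : 0 ≤ ∫ t : I, v t := integral_nonneg hv.1.1
  have hm1 : ∫ t : I, v t ≤ 1 := by
    refine (integral_nonneg_mono (by fun_prop) continuous_const (le_one_of_mem hv)).trans ?_
    simp
  have hN1 : ∫ t : I, v t ^ 2 ≤ 1 := by
    refine (integral_nonneg_mono (by fun_prop) continuous_const fun t =>
      pow_le_one₀ (hv.1.1 t) (le_one_of_mem hv t)).trans ?_
    simp
  have hN : (1 / 16 : ℝ) / 2 ≤ ∫ t : I, v t ^ 2 :=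
    half_le_integral (by fun_prop) (fun t => sq_nonneg _) fun t ht => by
      nlinarith [le_of_mem_middle hv ht]
  simp only [pow_zero, pow_one, integral_const, probReal_univ, smul_eq_mul, mul_one] at u0 u1
  norm_num at l0 l1 l2
  set m := ∫ t : I, v t
  set N := ∫ t : I, v t ^ 2 with hNdef
  have u1' : alpha v 1 ≤ N / 4 := by nlinarith
  have u2' : alpha v 2 ≤ N / 4 := by nlinarith
  -- `m / 4 ≤ m² + 1/64`, with `m² ≤ N` and `1/64 ≤ N / 2`. All terms at `3` and `10` are now
  -- multiples of `N`, and the positive one dominates.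
  have u0' : alpha v 0 ≤ 3 / 2 * N := by nlinarith [sq_nonneg (m - 1 / 8)]
  have ha₂ : a₂ = 1 / 100 := by norm_num [a₂]
  have ha₁ : a₁ = 1 / 400 := by norm_num [a₁]
  have ha₀ : a₀ = 1 := rfl
  obtain ⟨tm, tp, h1, h2, h3, h4, hB, hC⟩ := exists_factorization (A := a₂ * alpha v 2)
    (B := N - a₁ * alpha v 1) (C := a₀ * alpha v 0) (by rw [ha₂]; linarith)
    (by rw [ha₀]; linarith) (by rw [ha₀, ha₁, ha₂]; linarith) (by rw [ha₀, ha₁, ha₂]; linarith)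
    (by rw [ha₁, ha₂]; linarith)
  refine ⟨a₂ * alpha v 2, tm, tp, by rw [ha₂]; linarith, h1, h2, h3, h4, fun s => ?_, fun t => ?_⟩
  · rw [potential_radial, ← hNdef, hB, hC]
    ring
  · rw [energy_eq, ← hNdef, hB, hC]
    ring

theorem hasDerivAt_energy (v : C(I, ℝ)) (t : ℝ) :
    HasDerivAt (energy v) (potential (hammerstein (t • v)) (t • v) v) t := by
  have hc : Continuous fun s : ℝ => potential (hammerstein (s • v)) (s • v) v := by
    simp only [potential_radial]
    fun_prop
  exact intervalIntegral.integral_hasDerivAt_right (hc.intervalIntegrable _ _)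
    (hc.stronglyMeasurableAtFilter _ _) hc.continuousAt

theorem exists_critical_points {v : C(I, ℝ)} (hv : v ∈ normSlice coneK 1) :
    ∃ tm tp : ℝ, 0 < tm ∧ tm < 3 ∧ 10 < tp ∧ tp < 10 ^ 7 ∧
      (∀ t, potential (hammerstein (t • v)) (t • v) v = 0 ↔ t = tm ∨ t = tp) ∧
      (∀ t, 0 ≤ t → t ≠ tp → energy v t < energy v tp) ∧ IsLocalMin (energy v) tm := by
  obtain ⟨A, tm, tp, hA, h0, h1, h2, h3, hF, hE⟩ := exists_radial_profile hv
  refine ⟨tm, tp, h0, h1, h2, h3, fun t => ?_, fun t ht hne => ?_, ?_⟩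
  · rw [hF, neg_mul, neg_eq_zero, mul_eq_zero_iff_left hA.ne', mul_eq_zero, sub_eq_zero,
      sub_eq_zero]
  -- This product is `energy v tp - energy v t`, with the double root at `tp` split off. The last
  -- factor is positive for `t ≥ 0` since `tp > 3 * tm`.
  · have h : 0 < A * ((t - tp) ^ 2 * (t / 3 + (tp / 6 - tm / 2))) :=
      mul_pos hA (mul_pos (sq_pos_of_ne_zero (sub_ne_zero.2 hne)) (by linarith))
    rw [hE, hE]
    linarith
  · filter_upwards [Iio_mem_nhds (show tm < tp by linarith)] with t ht
    have h : 0 ≤ A * ((t - tm) ^ 2 * ((tp - tm) / 2 - (t - tm) / 3)) :=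
      mul_nonneg hA.le (mul_nonneg (sq_nonneg _) (by linarith [mem_Iio.1 ht]))
    rw [hE, hE]
    linarith

/-! ## The conditions on the radial maxima -/

theorem mem_radii_zero_top {t : ℝ} : t ∈ radii 0 ⊤ ↔ 0 ≤ t :=
  ⟨fun h => h.1, fun h => ⟨h, le_top⟩⟩

theorem isRadialMax_iff {v : C(I, ℝ)} {tp : ℝ} (hp : 0 ≤ tp)
    (h : ∀ t, 0 ≤ t → t ≠ tp → energy v t < energy v tp) (t : ℝ) :
    IsRadialMax hammerstein potential 0 ⊤ v t ↔ t = tp := by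
  constructor
  · rintro ⟨h1, h2⟩
    by_contra hne
    exact (h t (mem_radii_zero_top.1 h1) hne).not_ge (h2 tp (mem_radii_zero_top.2 hp))
  · rintro rfl
    refine ⟨mem_radii_zero_top.2 hp, fun s hs => ?_⟩
    rcases eq_or_ne s t with rfl | hne
    · exact le_rfl
    · exact (h s (mem_radii_zero_top.1 hs) hne).le

theorem condH1 : CondH1 coneK hammerstein potential 0 ⊤ := by
  refine ⟨10, 10 ^ 7, by norm_num, by norm_num, by norm_num, le_top, fun v hv => ?_⟩
  obtain ⟨tm, tp, -, -, h2, h3, -, hmax, -⟩ := exists_critical_points hv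
  have h := isRadialMax_iff (by linarith) hmax
  exact ⟨tp, (h tp).2 rfl, fun t' ht' => (h t').1 ht', h2, h3⟩

theorem condH2 : CondH2 coneK hammerstein potential 0 ⊤ := by
  refine lt_of_lt_of_le (ENNReal.ofReal_pos.2 (by norm_num : (0 : ℝ) < 1 / 64)) ?_
  refine le_iInf₂ fun u _ => ?_
  rw [← ofReal_norm]
  exact ENNReal.ofReal_le_ofReal (le_norm_hammerstein u)

/-- The functional equals `(1 - t) ‖u‖⁻¹ ∫ u²`, and the cone inequality keeps `∫ u²` positive. -/
theorem condH3 : CondH3 coneK potential := by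
  intro t _ u hu hne h
  have hn : 0 < ‖u‖ := norm_pos_iff.2 hne
  have hpos : ((1 / 4 * ‖u‖) ^ 2) / 2 ≤ ∫ s : I, u s ^ 2 :=
    half_le_integral (by fun_prop) (fun s => sq_nonneg _) fun s hs =>
      pow_le_pow_left₀ (by positivity) (hu.2 s (mem_middle.1 hs).1 (mem_middle.1 hs).2) 2
  have h1 : ∫ s : I, u s * (‖u‖⁻¹ • u) s = ‖u‖⁻¹ * ∫ s : I, u s ^ 2 := by
    rw [← integral_const_mul]
    congr 1
    ext s
    simp only [ContinuousMap.smul_apply, smul_eq_mul]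
    ring
  have h2 : ∫ s : I, (t • u) s * (‖u‖⁻¹ • u) s = t * (‖u‖⁻¹ * ∫ s : I, u s ^ 2) := by
    rw [← h1, ← integral_const_mul]
    congr 1
    ext s
    simp only [ContinuousMap.smul_apply, smul_eq_mul]
    ring
  rw [potential, h1, h2] at h
  have h3 : 0 < ‖u‖⁻¹ * ∫ s : I, u s ^ 2 :=
    mul_pos (inv_pos.2 hn) (lt_of_lt_of_le (by positivity) hpos)
  have h4 : (1 - t) * (‖u‖⁻¹ * ∫ s : I, u s ^ 2) = 0 := by linarith
  rcases mul_eq_zero.1 h4 with h5 | h5 <;> linarith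

/-- A fixed point of norm at least `3` lies on the Nehari-type manifold. -/
theorem mem_nehariManifold_of_fixed {u : C(I, ℝ)} (hu : hammerstein u = u) (h3 : 3 ≤ ‖u‖) :
    u ∈ nehariManifold coneK hammerstein potential 0 ⊤ := by
  have hn : 0 < ‖u‖ := by linarith
  have huK : u ∈ coneK := hu ▸ hammerstein_mem_coneK u
  have hv : ‖u‖⁻¹ • u ∈ normSlice coneK 1 :=
    ⟨isNondegenerateCone_coneK.smul_mem _ (inv_nonneg.2 hn.le) u huK, by
      rw [norm_smul, norm_inv, norm_norm, inv_mul_cancel₀ hn.ne']⟩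
  have huv : ‖u‖ • ‖u‖⁻¹ • u = u := by rw [smul_smul, mul_inv_cancel₀ hn.ne', one_smul]
  obtain ⟨tm, tp, -, h1, h2, -, hcrit, hmax, -⟩ := exists_critical_points hv
  -- At the fixed point both integrals in `potential` coincide, so `‖u‖` is a critical point; being
  -- at least `3`, it is not `tm`.
  have h := (hcrit ‖u‖).1 (by rw [huv, hu]; exact sub_self _)
  exact ⟨_, hv, ‖u‖, (isRadialMax_iff (by linarith) hmax _).2
    (h.resolve_left (by linarith)), huv.symm⟩

/-! ## Solutions of the boundary value problem are fixed points -/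

theorem integral_unitInterval_eq (F : ℝ → ℝ) : ∫ s : I, F s = ∫ s in (0 : ℝ)..1, F s := by
  rw [unitInterval.measurePreserving_coe.integral_comp unitInterval.measurableEmbedding_coe F,
    integral_Icc_eq_integral_Ioc, intervalIntegral.integral_of_le zero_le_one]

theorem green_of_le {t s : ℝ} (h : t ≤ s) : green t s = t * (1 - s) := if_pos h

theorem green_of_ge {t s : ℝ} (h : s ≤ t) : green t s = s * (1 - t) := by
  unfold green
  split_ifs with h'
  · rw [le_antisymm h h']
  · rfl

/-- Here `w = u'`. Split at the kink `s = t`; on each side the kernel is linear in `s`, so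
integration by parts gives an explicit antiderivative. -/
theorem hammerstein_eq_of_hasDerivAt {u w : ℝ → ℝ} (hu : Continuous u)
    (hw : ∀ t ∈ Icc (0 : ℝ) 1, HasDerivAt u (w t) t)
    (hw' : ∀ t ∈ Icc (0 : ℝ) 1, HasDerivAt w (-nonlin (u t)) t) (h0 : u 0 = 0) (h1 : u 1 = 0) :
    hammerstein ((⟨u, hu⟩ : C(ℝ, ℝ)).restrict I) = (⟨u, hu⟩ : C(ℝ, ℝ)).restrict I := by
  ext t
  have ht0 := t.2.1
  have ht1 := t.2.2
  have e : hammerstein ((⟨u, hu⟩ : C(ℝ, ℝ)).restrict I) t =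
      ∫ s in (0 : ℝ)..1, green t s * nonlin (u s) :=
    integral_unitInterval_eq fun s => green t s * nonlin (u s)
  have hc : Continuous fun s : ℝ => green t s * nonlin (u s) := by fun_prop
  rw [e, ← intervalIntegral.integral_add_adjacent_intervals
    (hc.intervalIntegrable 0 t) (hc.intervalIntegrable t 1)]
  have hl : ∫ s in (0 : ℝ)..t, green t s * nonlin (u s) = -(1 - t) * (t * w t - u t) := by
    rw [intervalIntegral.integral_eq_sub_of_hasDerivAt
      (f := fun s => -(1 - (t : ℝ)) * (s * w s - u s)) ?_ (hc.intervalIntegrable 0 t)]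
    · simp [h0]
    · intro s hs
      rw [uIcc_of_le ht0] at hs
      have hs' : s ∈ Icc (0 : ℝ) 1 := ⟨hs.1, hs.2.trans ht1⟩
      have h := (((hasDerivAt_id s).mul (hw' s hs')).sub (hw s hs')).const_mul (-(1 - (t : ℝ)))
      refine h.congr_deriv ?_
      rw [green_of_ge hs.2]
      simp only [id]
      ring
  have hr : ∫ s in (t : ℝ)..1, green t s * nonlin (u s) = t * ((1 - t) * w t + u t) := by
    rw [intervalIntegral.integral_eq_sub_of_hasDerivAt
      (f := fun s => -(t : ℝ) * ((1 - s) * w s + u s)) ?_ (hc.intervalIntegrable t 1)]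
    · simp [h1]
    · intro s hs
      rw [uIcc_of_le ht1] at hs
      have hs' : s ∈ Icc (0 : ℝ) 1 := ⟨ht0.trans hs.1, hs.2⟩
      have h := ((((hasDerivAt_id s).const_sub 1).mul (hw' s hs')).add
        (hw s hs')).const_mul (-(t : ℝ))
      refine h.congr_deriv ?_
      rw [green_of_le hs.1]
      simp only [id]
      ring
  rw [hl, hr]
  change _ = u t
  ring

/-! ## Autonomous scalar equations by separation of variables -/

/-- Separation of variables for `ρ' = 1 / h(ρ)`. Since `h ≥ c > 0`, the primitive grows at least
linearly both ways, hence is a bijection of `ℝ`, and `ρ` is its inverse. -/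
theorem exists_inverse_of_integral {h : ℝ → ℝ} (hh : Continuous h) {c : ℝ} (hc : 0 < c)
    (hch : ∀ s, c ≤ h s) (a : ℝ) :
    ∃ ρ : ℝ → ℝ, StrictMono ρ ∧ (∀ t, HasDerivAt ρ (h (ρ t))⁻¹ t) ∧
      ∀ s, ρ (∫ x in a..s, h x) = s := by
  set Φ : ℝ → ℝ := fun s => ∫ x in a..s, h x with hΦ
  have hd : ∀ s, HasDerivAt Φ (h s) s := fun s =>
    intervalIntegral.integral_hasDerivAt_right (hh.intervalIntegrable _ _)
      (hh.stronglyMeasurableAtFilter _ _) hh.continuousAt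
  have hmono : StrictMono Φ := strictMono_of_hasDerivAt_pos hd fun s => hc.trans_le (hch s)
  have hlin : Monotone fun s => Φ s - c * s :=
    monotone_of_hasDerivAt_nonneg (fun s => (hd s).sub ((hasDerivAt_id s).const_mul c))
      fun s => by simpa using hch s
  have hcont : Continuous Φ := continuous_iff_continuousAt.2 fun s => (hd s).continuousAt
  have htop : Tendsto Φ atTop atTop := by
    refine tendsto_atTop_mono' atTop (f₁ := fun s => Φ 0 + c * s) ?_
      (tendsto_atTop_add_const_left _ _ (tendsto_id.const_mul_atTop hc))
    filter_upwards [eventually_ge_atTop 0] with s hs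
    have := hlin hs
    simp only at this
    linarith
  have hbot : Tendsto Φ atBot atBot := by
    refine tendsto_atBot_mono' atBot (f₁ := fun s => Φ 0 + c * s) ?_
      (tendsto_atBot_add_const_left _ _ (tendsto_id.const_mul_atBot hc))
    filter_upwards [eventually_le_atBot 0] with s hs
    have := hlin hs
    simp only at this
    linarith
  let e := hmono.orderIsoOfSurjective Φ (hcont.surjective htop hbot)
  have he : ∀ t, Φ (e.symm t) = t := e.apply_symm_apply
  exact ⟨e.symm, e.symm.strictMono, fun t => HasDerivAt.of_local_left_inverse
    e.symm.continuous.continuousAt (hd _) (hc.trans_le (hch _)).ne' (Eventually.of_forall he),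
    e.symm_apply_apply⟩

/-! ## The time map -/

/-- With `G' = nonlin`, the polynomial `(G(M) - G(M (1 - s²))) / (M s²)`. -/
def timeQuot (M s : ℝ) : ℝ :=
  a₂ * M ^ 2 * (1 + (1 - s ^ 2) + (1 - s ^ 2) ^ 2) / 3 + a₁ * M * (1 + (1 - s ^ 2)) / 2 + a₀

theorem half_le_timeQuot (M s : ℝ) : 1 / 2 ≤ timeQuot M s := by
  unfold timeQuot a₂ a₁ a₀
  -- With `y = 1 - s²`, use `1 + y + y² = (3/4)(1 + y)² + (1/4)(1 - y)²` and complete the square in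
  -- `M(1 + y)`.
  nlinarith [sq_nonneg (M * (2 - s ^ 2) + 1 / 4), sq_nonneg (M * s ^ 2)]

theorem timeQuot_pos (M s : ℝ) : 0 < timeQuot M s := by linarith [half_le_timeQuot M s]

theorem continuous_timeQuot : Continuous fun p : ℝ × ℝ => timeQuot p.1 p.2 := by
  unfold timeQuot
  fun_prop

theorem hasDerivAt_timeQuot (M s : ℝ) : HasDerivAt (timeQuot M)
    (-2 * s * (a₂ * M ^ 2 * (1 + 2 * (1 - s ^ 2)) / 3 + a₁ * M / 2)) s := by
  have hy : HasDerivAt (fun s : ℝ => 1 - s ^ 2) (-2 * s) s := by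
    refine ((hasDerivAt_pow 2 s).const_sub 1).congr_deriv ?_
    push_cast
    ring
  have h := (((((hy.const_add 1).add (hy.pow 2)).const_mul (a₂ * M ^ 2)).div_const 3).add
    (((hy.const_add 1).const_mul (a₁ * M)).div_const 2)).add_const a₀
  refine h.congr_deriv ?_
  push_cast
  ring

theorem timeQuot_le {M s : ℝ} (hM : 0 ≤ M) (hs : s ∈ Icc (-1 : ℝ) 1) :
    timeQuot M s ≤ nonlin M := by
  have h1 : s ^ 2 ≤ 1 := by nlinarith [hs.1, hs.2]
  have h2 : (1 - s ^ 2) ^ 2 ≤ 1 := by nlinarith [sq_nonneg s]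
  unfold timeQuot nonlin a₂ a₁ a₀
  nlinarith [sq_nonneg s, mul_nonneg hM (sq_nonneg s),
    mul_nonneg (sq_nonneg M) (sub_nonneg.2 h2), mul_nonneg (sq_nonneg M) (sq_nonneg s)]

theorem le_timeQuot {M s : ℝ} (hM : 0 ≤ M) (hs : s ∈ Icc (-1 : ℝ) 1) :
    M ^ 2 / 300 ≤ timeQuot M s := by
  have h1 : 0 ≤ 1 - s ^ 2 := by nlinarith [hs.1, hs.2]
  unfold timeQuot a₂ a₁ a₀
  nlinarith [mul_nonneg hM h1, mul_nonneg (sq_nonneg M) h1,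
    mul_nonneg (sq_nonneg M) (sq_nonneg (1 - s ^ 2))]

/-- At `M = 20` the integrand is at least `1`, as `f(20) ≤ 40`; at `M = 2400` it is at most `1/2`,
as `2400² / 300 = 4 * 4800`. Continuity in `M` gives a value in between. -/
theorem exists_timeMap_eq_one : ∃ M : ℝ, 20 ≤ M ∧
    ∫ s in (-1 : ℝ)..1, √(2 * M / timeQuot M s) = 1 := by
  have hc : Continuous fun p : ℝ × ℝ => √(2 * p.1 / timeQuot p.1 p.2) :=
    ((continuous_const.mul continuous_fst).div continuous_timeQuot
      fun p => (timeQuot_pos _ _).ne').sqrt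
  have hcM : ∀ M : ℝ, Continuous fun s : ℝ => √(2 * M / timeQuot M s) := fun M =>
    hc.comp (Continuous.prodMk_right M)
  have hτ : Continuous fun M : ℝ => ∫ s in (-1 : ℝ)..1, √(2 * M / timeQuot M s) :=
    intervalIntegral.continuous_parametric_intervalIntegral_of_continuous' hc _ _
  have hconst : ∀ c : ℝ, ∫ _ in (-1 : ℝ)..1, c = 2 * c := fun c => by
    rw [intervalIntegral.integral_const, smul_eq_mul]
    ring
  have hlo : 1 ≤ ∫ s in (-1 : ℝ)..1, √(2 * 20 / timeQuot 20 s) := by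
    have h : ∫ _ in (-1 : ℝ)..1, (1 : ℝ) ≤ ∫ s in (-1 : ℝ)..1, √(2 * 20 / timeQuot 20 s) :=
      intervalIntegral.integral_mono_on (by norm_num) (by simp) ((hcM 20).intervalIntegrable _ _)
        fun s hs => by
          rw [Real.one_le_sqrt, one_le_div (timeQuot_pos _ _)]
          refine (timeQuot_le (by norm_num) hs).trans ?_
          norm_num [nonlin, a₂, a₁, a₀]
    rw [hconst] at h
    linarith
  have hhi : ∫ s in (-1 : ℝ)..1, √(2 * 2400 / timeQuot 2400 s) ≤ 1 := by
    have h : ∫ s in (-1 : ℝ)..1, √(2 * 2400 / timeQuot 2400 s) ≤ ∫ _ in (-1 : ℝ)..1, (1 / 2 : ℝ) :=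
      intervalIntegral.integral_mono_on (by norm_num) ((hcM 2400).intervalIntegrable _ _) (by simp)
        fun s hs => by
          refine Real.sqrt_le_iff.2 ⟨by norm_num, ?_⟩
          rw [div_le_iff₀ (timeQuot_pos _ _)]
          linarith [le_timeQuot (M := 2400) (by norm_num) hs]
    rw [hconst] at h
    linarith
  obtain ⟨M, hM, h⟩ := intermediate_value_Icc' (by norm_num) hτ.continuousOn ⟨hhi, hlo⟩
  exact ⟨M, hM.1, h⟩

theorem exists_large_fixed_point : ∃ u : C(I, ℝ), hammerstein u = u ∧ 20 ≤ ‖u‖ := by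
  obtain ⟨M, hM, hτ⟩ := exists_timeMap_eq_one
  have hM0 : 0 < M := by linarith
  have hqc : Continuous (timeQuot M) := continuous_timeQuot.comp (Continuous.prodMk_right M)
  -- The upper bound on `timeQuot` holds only on `[-1, 1]`; clamping bounds the integrand below on
  -- all of `ℝ` and changes nothing for `t ∈ [0, 1]`.
  let κ : ℝ → ℝ := fun s => max (-1) (min 1 s)
  have hκ : ∀ s, κ s ∈ Icc (-1 : ℝ) 1 := fun s =>
    ⟨le_max_left _ _, max_le (by norm_num) (min_le_left _ _)⟩
  have hκe : ∀ s ∈ Icc (-1 : ℝ) 1, κ s = s := fun s hs => by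
    simp only [κ]
    rw [min_eq_right hs.2, max_eq_right hs.1]
  have hf : 0 < nonlin M := by linarith [half_le_nonlin M]
  obtain ⟨ρ, hmono, hρ', hρ⟩ := exists_inverse_of_integral
    (h := fun s => √(2 * M / timeQuot M (κ s)))
    ((continuous_const.div (hqc.comp (by fun_prop)) fun s => (timeQuot_pos _ _).ne').sqrt)
    (c := √(2 * M / nonlin M)) (by positivity)
    (fun s => Real.sqrt_le_sqrt
      (div_le_div_of_nonneg_left (by linarith) (timeQuot_pos _ _) (timeQuot_le hM0.le (hκ s))))
    (-1)
  have hρ0 : ρ 0 = -1 := by simpa using hρ (-1)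
  have hρ1 : ρ 1 = 1 := by
    have h := hρ 1
    rwa [intervalIntegral.integral_congr (g := fun s => √(2 * M / timeQuot M s)) fun s hs => by
      rw [uIcc_of_le (by norm_num)] at hs
      simp only [hκe s hs], hτ] at h
  have hρI : ∀ t ∈ Icc (0 : ℝ) 1, ρ t ∈ Icc (-1 : ℝ) 1 := fun t ht =>
    ⟨hρ0 ▸ hmono.monotone ht.1, hρ1 ▸ hmono.monotone ht.2⟩
  have hρd : ∀ t ∈ Icc (0 : ℝ) 1, HasDerivAt ρ √(timeQuot M (ρ t) / (2 * M)) t := fun t ht => by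
    have h := hρ' t
    rwa [hκe _ (hρI t ht), ← Real.sqrt_inv, inv_div] at h
  have hρc : Continuous ρ := continuous_iff_continuousAt.2 fun t => (hρ' t).continuousAt
  have hu : Continuous fun t => M * (1 - ρ t ^ 2) := by fun_prop
  refine ⟨(⟨_, hu⟩ : C(ℝ, ℝ)).restrict I, hammerstein_eq_of_hasDerivAt hu
    (w := fun t => -2 * M * (ρ t * √(timeQuot M (ρ t) / (2 * M)))) (fun t ht => ?_)
    (fun t ht => ?_) (by simp [hρ0]) (by simp [hρ1]), ?_⟩
  · have h := (((hρd t ht).pow 2).const_sub 1).const_mul M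
    refine h.congr_deriv ?_
    push_cast
    ring
  -- The computation reduces to `q(s) + s q'(s) / 2 = f(M(1 - s²))`, the derivative of `M s² q(s) =
  -- G(M) - G(M(1 - s²))`.
  · have hq : 0 < timeQuot M (ρ t) / (2 * M) := div_pos (timeQuot_pos _ _) (by linarith)
    have h := ((hρd t ht).mul ((((hasDerivAt_timeQuot M (ρ t)).comp t (hρd t ht)).div_const
      (2 * M)).sqrt hq.ne')).const_mul (-2 * M)
    refine h.congr_deriv ?_
    simp only [Function.comp_apply]
    have hg := Real.mul_self_sqrt hq.le
    have hg0 : √(timeQuot M (ρ t) / (2 * M)) ≠ 0 := (Real.sqrt_pos.2 hq).ne'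
    set g := √(timeQuot M (ρ t) / (2 * M))
    rw [hg]
    field_simp
    unfold timeQuot nonlin
    ring
  · obtain ⟨t, ht, h0⟩ : (0 : ℝ) ∈ ρ '' Icc 0 1 :=
      intermediate_value_Icc zero_le_one hρc.continuousOn (by rw [hρ0, hρ1]; norm_num)
    have h := ((⟨_, hu⟩ : C(ℝ, ℝ)).restrict I).norm_coe_le_norm ⟨t, ht⟩
    have h2 : ((⟨_, hu⟩ : C(ℝ, ℝ)).restrict I) ⟨t, ht⟩ = M := by
      change M * (1 - ρ t ^ 2) = M
      rw [h0]
      ring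
    rw [h2] at h
    exact hM.trans ((le_abs_self M).trans h)

end NehariCone

end

theorem mainTheorem6 :
    -- the standing assumptions on the cone, the operator and the functional
    NehariCone.IsNondegenerateCone NehariCone.coneK ∧
    NehariCone.CompletelyContinuousOn NehariCone.hammerstein Set.univ ∧
    Set.MapsTo NehariCone.hammerstein NehariCone.coneK NehariCone.coneK ∧
    ContinuousOn
      (fun p : C(unitInterval, ℝ) × C(unitInterval, ℝ) × C(unitInterval, ℝ) =>
        NehariCone.potential p.1 p.2.1 p.2.2)
      (NehariCone.coneK ×ˢ NehariCone.coneK ×ˢ NehariCone.normSlice NehariCone.coneK 1) ∧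
    -- in each direction the radial energy is a cubic with exactly two critical points
    (∀ v ∈ NehariCone.normSlice NehariCone.coneK 1,
      0 < NehariCone.alpha v 2 ∧
      (∀ t : ℝ, 0 ≤ t → NehariCone.energy v t =
        -NehariCone.a₂ * (t ^ 3 / 3) * NehariCone.alpha v 2
          + t ^ 2 / 2 * ((∫ s : unitInterval, v s ^ 2) - NehariCone.a₁ * NehariCone.alpha v 1)
          - NehariCone.a₀ * NehariCone.alpha v 0 * t) ∧
      ∃ tm tp : ℝ, 0 < tm ∧ tm < tp ∧ 10 < tp ∧ tp < 10 ^ 7 ∧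
        -- the critical points in `(0, ∞)` are `tm` and `tp`
        (∀ t : ℝ, 0 < t → (HasDerivAt (NehariCone.energy v) 0 t ↔ t = tm ∨ t = tp)) ∧
        -- `tp` is the unique global maximum point, `tm` is a local minimum point
        (∀ t : ℝ, 0 ≤ t → t ≠ tp → NehariCone.energy v t < NehariCone.energy v tp) ∧
        IsLocalMin (NehariCone.energy v) tm) ∧
    -- conditions (h1), (h2), (h3) with `r = 0`, `R = ∞`
    NehariCone.CondH1 NehariCone.coneK NehariCone.hammerstein NehariCone.potential 0 ⊤ ∧
    NehariCone.CondH2 NehariCone.coneK NehariCone.hammerstein NehariCone.potential 0 ⊤ ∧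
    NehariCone.CondH3 NehariCone.coneK NehariCone.potential ∧
    -- the fixed point on the Nehari-type manifold
    ∃ u ∈ NehariCone.nehariManifold NehariCone.coneK NehariCone.hammerstein
        NehariCone.potential 0 ⊤,
      NehariCone.hammerstein u = u := by
  obtain ⟨u, hu, hn⟩ := NehariCone.exists_large_fixed_point
  refine ⟨NehariCone.isNondegenerateCone_coneK, NehariCone.completelyContinuousOn_hammerstein,
    fun u _ => NehariCone.hammerstein_mem_coneK u, NehariCone.continuous_potential.continuousOn,
    fun v hv => ⟨?_, fun t _ => NehariCone.energy_eq v t, ?_⟩, NehariCone.condH1,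
    NehariCone.condH2, NehariCone.condH3, u,
    NehariCone.mem_nehariManifold_of_fixed hu (by linarith), hu⟩
  · exact lt_of_lt_of_le (by norm_num) (NehariCone.le_alpha hv 2)
  · obtain ⟨tm, tp, h0, h1, h2, h3, hcrit, hmax, hmin⟩ := NehariCone.exists_critical_points hv
    refine ⟨tm, tp, h0, by linarith, h2, h3, fun t _ => ?_, hmax, hmin⟩
    rw [← hcrit t]
    have hd := NehariCone.hasDerivAt_energy v t
    exact ⟨fun h => hd.unique h, fun h => h ▸ hd⟩
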